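/- A $2$-group $G$ is called \emph{generalized extraspecial} if its Frattini subgroup $\Phi(G)$ is central and $\Phi(G)=[G,G]\cong\mathbb{Z}_2$. For such a $G$, write $\Phi(G)=\langle c\rangle$ and let $V=G/\Phi(G)$, a vector space over $\mathbb{Z}_2$; the associated quadratic form is $Q_G\colon V\to\mathbb{Z}_2$, $Q_G([g])=k$ where $g^2=c^k$, with bilinear form $B_Q(u,v)=Q(u+v)-Q(u)-Q(v)$. A quadratic form $Q\colon V\to\mathbb{Z}_2$ is \emph{admissible} if $V$ has a finite basis $\{v_1,\dots,v_\ell\}$ such that $Q(v_i)=1$ for all $i$ and for each $i$ there is a $j$ with $B_Q(v_i,v_j)=1$. For groups $G_1,G_2$ whose Frattini subgroups $\langle c_1\rangle,\langle c_2\rangle$ are central of order two, the central product is $G_1*G_2=(G_1\times G_2)/\langle(c_1,c_2)\rangle$, and $G^{*m}=G*\cdots*G$ ($m\ge 1$ factors). Corollary. Let $G$ be a generalized extraspecial $2$-group whose associated quadratic form $Q_G$ is admissible. Then there is an integer $n\ge 0$ such that $G\cong G'\times\mathbb{Z}_2^{n}$, where $G'$ is one of $$Q_8^{*m}\ (m\ge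 1),\qquad Q_8^{*(m-1)}*D_8\ (m\ge 2),\qquad Q_8^{*m}*\mathbb{Z}_4\ (m\ge 2).$$ Here $Q_8$ is the quaternion group and $D_8$ the dihedral group of order $8$. -/

import Mathlib

/-- A `2`-group `G` is *generalized extraspecial* if its Frattini subgroup `Φ(G)` is central and
`Φ(G) = [G, G]` is cyclic of order two. -/
class IsGeneralizedExtraspecial (G : Type*) [Group G] : Prop where
  isPGroup : IsPGroup 2 G
  frattini_le_center : frattini G ≤ Subgroup.center G
  frattini_eq_commutator : frattini G = commutator G
  card_frattini : Nat.card (frattini G) = 2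

/-- The quotient `V = G / Φ(G)`, written additively. -/
def FrattiniQuotient (G : Type*) [Group G] : Type _ := Additive (G ⧸ frattini G)

namespace FrattiniQuotient

/-- The class `[g] ∈ V` of an element `g` of `G`. -/
def mk {G : Type*} [Group G] (g : G) : FrattiniQuotient G :=
  Additive.ofMul (QuotientGroup.mk g : G ⧸ frattini G)

theorem ind {G : Type*} [Group G] {p : FrattiniQuotient G → Prop} (h : ∀ g, p (mk g))
    (v : FrattiniQuotient G) : p v := by
  obtain ⟨g, hg⟩ := QuotientGroup.mk_surjective (Additive.toMul v : G ⧸ frattini G)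
  have : v = mk g := congrArg Additive.ofMul hg.symm
  exact this ▸ h g

end FrattiniQuotient

namespace IsGeneralizedExtraspecial

open scoped commutatorElement

variable {G : Type*} [Group G] [IsGeneralizedExtraspecial G]

theorem commutator_mem (g h : G) : ⁅g, h⁆ ∈ frattini G := by
  rw [frattini_eq_commutator, commutator_def]
  exact Subgroup.commutator_mem_commutator (Subgroup.mem_top g) (Subgroup.mem_top h)

theorem comm_of_mem {z : G} (hz : z ∈ frattini G) (g : G) : g * z = z * g :=
  Subgroup.mem_center_iff.1 (frattini_le_center hz) g

theorem sq_mem (g : G) : g ^ 2 ∈ frattini G := by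
  have key : ∀ M : Subgroup G, IsCoatom M → g ^ 2 ∈ M := by
    intro M hM
    by_contra hg
    have hn : M.Normal := by
      refine ⟨fun n hn x => ?_⟩
      have h1 := M.mul_mem (frattini_le_coatom hM (commutator_mem x n)) hn
      simpa [commutatorElement_def] using h1
    have htop : Subgroup.zpowers (g ^ 2) ⊔ M = ⊤ :=
      hM.2 _ (lt_of_le_of_ne le_sup_right fun h =>
        hg (h ▸ (le_sup_left : _ ≤ Subgroup.zpowers (g ^ 2) ⊔ M) (Subgroup.mem_zpowers _)))
    have hgt : g ∈ Subgroup.zpowers (g ^ 2) ⊔ M := by rw [htop]; exact Subgroup.mem_top g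
    obtain ⟨y, hy, m, hm, hym⟩ := Subgroup.mem_sup_of_normal_right.1 hgt
    obtain ⟨k, rfl⟩ := Subgroup.mem_zpowers_iff.1 hy
    have h1 : g ^ (1 - 2 * k) ∈ M := by
      have : g ^ (1 - 2 * k) = m := by
        have h2 : (g ^ 2) ^ k = g ^ (2 * k) := by rw [zpow_mul]; norm_cast
        rw [h2] at hym
        rw [sub_eq_neg_add, zpow_add, zpow_neg, zpow_one, inv_mul_eq_iff_eq_mul]
        exact hym.symm
      exact this ▸ hm
    obtain ⟨n, hn2⟩ := (isPGroup (G := G)) g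
    have hcop : IsCoprime (1 - 2 * k) ((2 : ℤ) ^ n) :=
      IsCoprime.pow_right ⟨1, k, by ring⟩
    obtain ⟨a, b, hab⟩ := hcop
    have h3 : g ∈ M := by
      have h4 : g = (g ^ (1 - 2 * k)) ^ a * (g ^ ((2 : ℤ) ^ n)) ^ b := by
        rw [← zpow_mul, ← zpow_mul, ← zpow_add, mul_comm _ a, mul_comm _ b, hab, zpow_one]
      have h5 : g ^ ((2 : ℤ) ^ n) = 1 := by exact_mod_cast hn2
      rw [h4, h5, one_zpow, mul_one]
      exact M.zpow_mem h1 a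
    exact hg (M.pow_mem h3 2)
  simp only [frattini, Order.radical, Subgroup.mem_iInf]
  exact key

theorem sq_eq_one_of_mem {z : G} (hz : z ∈ frattini G) : z ^ 2 = 1 := by
  have h := pow_card_eq_one' (x := (⟨z, hz⟩ : frattini G))
  rw [card_frattini] at h
  exact congrArg Subtype.val h

theorem eq_of_mem {x y : G} (hx : x ∈ frattini G) (hy : y ∈ frattini G) (hx1 : x ≠ 1)
    (hy1 : y ≠ 1) : x = y := by
  obtain ⟨a, b, hab, huniv⟩ := Nat.card_eq_two_iff.1 (card_frattini (G := G))
  have hmem : ∀ z : frattini G, z = a ∨ z = b := fun z => by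
    have : z ∈ ({a, b} : Set (frattini G)) := huniv ▸ Set.mem_univ z
    simpa using this
  have h : (⟨x, hx⟩ : frattini G) = ⟨y, hy⟩ := by
    have hx' : (⟨x, hx⟩ : frattini G) ≠ 1 := fun h => hx1 (congrArg Subtype.val h)
    have hy' : (⟨y, hy⟩ : frattini G) ≠ 1 := fun h => hy1 (congrArg Subtype.val h)
    rcases hmem 1 with h1 | h1 <;> rcases hmem ⟨x, hx⟩ with h2 | h2 <;>
      rcases hmem ⟨y, hy⟩ with h3 | h3 <;> simp_all
  exact congrArg Subtype.val h

instance instAddCommGroup : AddCommGroup (FrattiniQuotient G) :=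
  { (inferInstance : AddGroup (Additive (G ⧸ frattini G))) with
    add_comm := by
      refine FrattiniQuotient.ind fun g => FrattiniQuotient.ind fun h => ?_
      change Additive.ofMul ((g * h : G) : G ⧸ frattini G) =
        Additive.ofMul ((h * g : G) : G ⧸ frattini G)
      refine congrArg _ (QuotientGroup.eq.2 ?_)
      have := commutator_mem h⁻¹ g⁻¹
      simpa [commutatorElement_def, mul_assoc] using this }

theorem mk_mul (g h : G) :
    FrattiniQuotient.mk (g * h) = FrattiniQuotient.mk g + FrattiniQuotient.mk h := rfl

theorem mk_one : FrattiniQuotient.mk (1 : G) = 0 := rfl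

/-- `V = G / Φ(G)` is a vector space over `ℤ/2`. -/
instance instModule : Module (ZMod 2) (FrattiniQuotient G) :=
  AddCommGroup.zmodModule (n := 2) (by
    refine FrattiniQuotient.ind fun g => ?_
    rw [two_nsmul, ← mk_mul, ← mk_one, ← pow_two]
    exact congrArg Additive.ofMul ((QuotientGroup.eq_one_iff (N := frattini G) _).2 (sq_mem g)))

open Classical in
/-- The exponent `k ∈ ℤ/2` with `x = c ^ k`, for `x ∈ Φ(G) = ⟨c⟩ = {1, c}`. -/
noncomputable def exponent (x : G) : ZMod 2 := if x = 1 then 0 else 1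

theorem exponent_mul {x y : G} (hx : x ∈ frattini G) (hy : y ∈ frattini G) :
    exponent (x * y) = exponent x + exponent y := by
  by_cases hx1 : x = 1
  · rw [hx1, one_mul]; simp [exponent]
  by_cases hy1 : y = 1
  · rw [hy1, mul_one]; simp [exponent]
  have h : x * y = 1 := by rw [eq_of_mem hx hy hx1 hy1, ← pow_two, sq_eq_one_of_mem hy]
  simp only [exponent, h, hx1, hy1, if_true, if_false]
  decide

/-- The function `Q_G : V → ℤ/2` with `Q_G([g]) = k`, where `g ^ 2 = c ^ k`. -/
noncomputable def squareMap (v : FrattiniQuotient G) : ZMod 2 :=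
  Quotient.liftOn' (Additive.toMul v : G ⧸ frattini G) (fun g => exponent (g ^ 2)) (by
    intro g h hgh
    have hz := QuotientGroup.leftRel_apply.1 hgh
    have h1 : h = g * (g⁻¹ * h) := by group
    generalize g⁻¹ * h = z at hz h1
    have h2 : h ^ 2 = g ^ 2 := by
      rw [h1, (show Commute g z from comm_of_mem hz g).mul_pow, sq_eq_one_of_mem hz, mul_one]
    simp only [h2])

theorem squareMap_mk (g : G) : squareMap (FrattiniQuotient.mk g) = exponent (g ^ 2) := rfl

theorem polar_squareMap (g h : G) :
    QuadraticMap.polar squareMap (FrattiniQuotient.mk g) (FrattiniQuotient.mk h) =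
      exponent ⁅h, g⁆ := by
  have h1 : (g * h) ^ 2 = ⁅h, g⁆ * (g ^ 2 * h ^ 2) := by
    have hc := comm_of_mem (commutator_mem h g) g
    calc (g * h) ^ 2 = g * ⁅h, g⁆ * (g * h * h) := by
          simp only [commutatorElement_def, pow_two]; group
      _ = ⁅h, g⁆ * (g ^ 2 * h ^ 2) := by rw [hc]; simp only [pow_two, mul_assoc]
  rw [QuadraticMap.polar, ← mk_mul, squareMap_mk, squareMap_mk, squareMap_mk, h1,
    exponent_mul (commutator_mem h g) (mul_mem (sq_mem g) (sq_mem h)),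
    exponent_mul (sq_mem g) (sq_mem h)]
  ring

variable (G) in
/-- The quadratic form `Q_G` on the `ℤ/2`-vector space `V = G / Φ(G)` associated with a
generalized extraspecial `2`-group `G`. -/
noncomputable def quadraticForm : QuadraticForm (ZMod 2) (FrattiniQuotient G) :=
  QuadraticMap.ofPolar squareMap
    (by
      intro a v
      have h0 : squareMap (0 : FrattiniQuotient G) = 0 := by
        rw [← mk_one, squareMap_mk]; simp [exponent]
      obtain rfl | rfl : a = 0 ∨ a = 1 := by revert a; decide
      · simp [h0]
      · simp)
    (by
      refine FrattiniQuotient.ind fun g => FrattiniQuotient.ind fun g' =>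
        FrattiniQuotient.ind fun h => ?_
      rw [← mk_mul, polar_squareMap, polar_squareMap, polar_squareMap,
        ← exponent_mul (commutator_mem h g) (commutator_mem h g')]
      have hc := comm_of_mem (commutator_mem h g') g
      congr 1
      calc ⁅h, g * g'⁆ = ⁅h, g⁆ * (g * ⁅h, g'⁆ * g⁻¹) := by
            simp only [commutatorElement_def]; group
        _ = ⁅h, g⁆ * ⁅h, g'⁆ := by rw [hc, mul_inv_cancel_right])
    (by
      intro a v w
      have h0 : squareMap (0 : FrattiniQuotient G) = 0 := by
        rw [← mk_one, squareMap_mk]; simp [exponent]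
      obtain rfl | rfl : a = 0 ∨ a = 1 := by revert a; decide
      · simp [QuadraticMap.polar, h0]
      · simp)

/-- The defining property of `Q_G`: if `Φ(G) = ⟨c⟩`, then `g ^ 2 = c ^ Q_G([g])`. -/
theorem sq_eq_pow_quadraticForm {c : G} (hc : Subgroup.zpowers c = frattini G) (g : G) :
    g ^ 2 = c ^ (quadraticForm G (FrattiniQuotient.mk g)).val := by
  have hcm : c ∈ frattini G := hc ▸ Subgroup.mem_zpowers c
  change g ^ 2 = c ^ (exponent (g ^ 2)).val
  by_cases h : g ^ 2 = 1
  · simp [exponent, h]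
  · have hc1 : c ≠ 1 := by
      rintro rfl
      have := sq_mem g
      rw [← hc] at this
      exact h (by simpa using this)
    rw [eq_of_mem (sq_mem g) hcm h hc1]
    simp [exponent, hc1, ZMod.val_one]

end IsGeneralizedExtraspecial

/-- A quadratic form `Q` over `ℤ/2` is *admissible* if `V` has a finite basis `v₁, …, v_ℓ` such
that `Q(v_i) = 1` for all `i`, and for each `v_i` there is `v_j` with `B_Q(v_i, v_j) = 1`, where
`B_Q(u, v) = Q(u + v) - Q(u) - Q(v)`. -/
def QuadraticForm.IsAdmissible {V : Type*} [AddCommGroup V] [Module (ZMod 2) V]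
    (Q : QuadraticForm (ZMod 2) V) : Prop :=
  ∃ (l : ℕ) (v : Module.Basis (Fin l) (ZMod 2) V),
    (∀ i, Q (v i) = 1) ∧ ∀ i, ∃ j, QuadraticMap.polar Q (v i) (v j) = 1

/-- The central product `G₁ * G₂ = (G₁ × G₂) / ⟨(c₁, c₂)⟩` of two groups whose Frattini subgroups
`⟨c₁⟩` and `⟨c₂⟩` are central of order two. (Then `c₁` and `c₂` are uniquely determined, and the
central subgroup `⟨(c₁, c₂)⟩` is its own normal closure.) -/
def CentralProduct (G₁ G₂ : Type*) [Group G₁] [Group G₂] : Type _ :=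
  (G₁ × G₂) ⧸ Subgroup.normalClosure
    {c : G₁ × G₂ | Subgroup.zpowers c.1 = frattini G₁ ∧ Subgroup.zpowers c.2 = frattini G₂}

instance (G₁ G₂ : Type*) [Group G₁] [Group G₂] : Group (CentralProduct G₁ G₂) :=
  inferInstanceAs (Group ((G₁ × G₂) ⧸ Subgroup.normalClosure _))

/-- The central product power `G^{*m} = G * ⋯ * G` with `m ≥ 1` factors; for `m = 0`, which is not
used, this is the trivial group. -/
def CentralPower (G : Type) [Group G] : ℕ → GrpCat.{0}
  | 0 => GrpCat.of PUnit
  | 1 => GrpCat.of G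
  | m + 2 => GrpCat.of (CentralProduct (CentralPower G (m + 1)) G)

/-!
A group `G` with a central involution `c` such that `G / ⟨c⟩` is an elementary abelian `2`-group `V`
is an extension of the quadratic space `(V, Q)`, where `g ^ 2 = c ^ Q(g)`
(`QuadraticExtension`). The quadratic space determines the group
(`QuadraticExtension.nonempty_mulEquiv`): in the fibre product of two extensions `G`, `H` of the same
space, all squares lie in the diagonal subgroup `⟨(c, c')⟩`, and an index-two subgroup that contains
`(c, c')` but not `(c, 1)` is the graph of an isomorphism `G ≃* H`.

Central products extend orthogonal sums, and direct factors `ℤ/2` add zero forms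
(`QuadraticExtension.centralProduct`, `QuadraticExtension.prodElementary`). The groups `Q₈`, `D₈` and
`ℤ/4` extend the anisotropic plane, the hyperbolic plane and the line with form `x ^ 2`. The theorem
is thereby reduced to quadratic forms over `ℤ/2`.

Every such form is the sum of `m` anisotropic planes, of at most one hyperbolic plane or line
`x ^ 2`, and of a zero form (`QuadraticForm.exists_equivalent_planePow_prod`): split off planes one
by one, replace two hyperbolic planes by two anisotropic ones, and make a hyperbolic plane
anisotropic by adding the generator of a line `x ^ 2` to its basis. In an admissible space the
vectors of value `1` outside the radical span (`QuadraticForm.IsAdmissible.eq_zero_of_forall`). This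
excludes a hyperbolic plane with `m = 0` and a line `x ^ 2` with `m ≤ 1`. Since `G` is not abelian,
`m = 0` is excluded in the remaining case too.
-/

/-! ### Quadratic forms over `ℤ/2` -/

namespace QuadraticForm

open _root_.QuadraticMap (polar polar_add_left polar_smul_left polar_smul_right polar_comm polar_prod
  linMulLin)

section Rearrange

variable {V₁ V₂ V₃ : Type*} [AddCommGroup V₁] [AddCommGroup V₂] [AddCommGroup V₃]
  [Module (ZMod 2) V₁] [Module (ZMod 2) V₂] [Module (ZMod 2) V₃]

theorem equivalent_prod_comm (Q₁ : QuadraticForm (ZMod 2) V₁) (Q₂ : QuadraticForm (ZMod 2) V₂) :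
    (Q₁.prod Q₂).Equivalent (Q₂.prod Q₁) :=
  ⟨QuadraticMap.IsometryEquiv.prodComm Q₁ Q₂⟩

theorem equivalent_prod_assoc (Q₁ : QuadraticForm (ZMod 2) V₁) (Q₂ : QuadraticForm (ZMod 2) V₂)
    (Q₃ : QuadraticForm (ZMod 2) V₃) :
    ((Q₁.prod Q₂).prod Q₃).Equivalent (Q₁.prod (Q₂.prod Q₃)) :=
  ⟨{ LinearEquiv.prodAssoc (ZMod 2) V₁ V₂ V₃ with
      map_app' := fun x => by simp [add_assoc] }⟩

theorem equivalent_prod_left_comm (Q₁ : QuadraticForm (ZMod 2) V₁)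
    (Q₂ : QuadraticForm (ZMod 2) V₂) (Q₃ : QuadraticForm (ZMod 2) V₃) :
    (Q₁.prod (Q₂.prod Q₃)).Equivalent (Q₂.prod (Q₁.prod Q₃)) :=
  (equivalent_prod_assoc Q₁ Q₂ Q₃).symm.trans
    (((equivalent_prod_comm Q₁ Q₂).prod (.refl Q₃)).trans (equivalent_prod_assoc Q₂ Q₁ Q₃))

end Rearrange

/-- The nonsingular quadratic form `ε x² + x y + ε y²` on `(ℤ/2)²`: the hyperbolic plane for
`ε = 0`, the anisotropic plane for `ε = 1`. -/
def plane (ε : ZMod 2) : QuadraticForm (ZMod 2) (ZMod 2 × ZMod 2) :=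
  linMulLin (.fst _ _ _) (.snd _ _ _) +
    ε • (linMulLin (.fst _ _ _) (.fst _ _ _) + linMulLin (.snd _ _ _) (.snd _ _ _))

@[simp]
theorem plane_apply (ε : ZMod 2) (x : ZMod 2 × ZMod 2) :
    plane ε x = x.1 * x.2 + ε * (x.1 * x.1 + x.2 * x.2) := rfl

/-- The orthogonal sum of `m` anisotropic planes. -/
def planePow (m : ℕ) : QuadraticForm (ZMod 2) (Fin m → ZMod 2 × ZMod 2) :=
  QuadraticMap.pi fun _ => plane 1

theorem planePow_apply {m : ℕ} (x : Fin m → ZMod 2 × ZMod 2) :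
    planePow m x = ∑ i, plane 1 (x i) :=
  QuadraticMap.pi_apply _ _

theorem plane_one_prod_planePow_equivalent (m : ℕ) :
    ((plane 1).prod (planePow m)).Equivalent (planePow (m + 1)) :=
  ⟨{ Fin.consLinearEquiv (ZMod 2) (fun _ : Fin (m + 1) => ZMod 2 × ZMod 2) with
      map_app' := fun x => by
        simp only [planePow_apply, QuadraticMap.prod_apply]
        rw [Fin.sum_univ_succ]
        rfl }⟩

theorem planePow_one_equivalent : (planePow 1).Equivalent (plane 1) :=
  ⟨{ LinearEquiv.funUnique (Fin 1) (ZMod 2) (ZMod 2 × ZMod 2) with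
      map_app' := fun x => by
        rw [planePow_apply, Fin.sum_univ_one]
        rfl }⟩

theorem planePow_prod_plane_one_prod_equivalent (m : ℕ) {V : Type*} [AddCommGroup V]
    [Module (ZMod 2) V] (T : QuadraticForm (ZMod 2) V) :
    ((planePow m).prod ((plane 1).prod T)).Equivalent ((planePow (m + 1)).prod T) :=
  (equivalent_prod_left_comm _ _ _).trans
    ((equivalent_prod_assoc _ _ _).symm.trans
      ((plane_one_prod_planePow_equivalent m).prod (.refl T)))

/-- The sum of two hyperbolic planes, with hyperbolic pairs `x₁, y₁` and `x₂, y₂`, is also the sum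
of the anisotropic planes spanned by `x₁ + y₁, x₁ + x₂ + y₂` and by `x₂ + y₂, x₁ + y₁ + x₂`. -/
theorem plane_zero_prod_plane_zero_equivalent :
    ((plane 0).prod (plane 0)).Equivalent ((plane 1).prod (plane 1)) := by
  refine QuadraticMap.Equivalent.symm ⟨{
      toFun := fun p =>
        ((p.1.1 + p.1.2 + p.2.2, p.1.1 + p.2.2), (p.1.2 + p.2.1 + p.2.2, p.1.2 + p.2.1))
      invFun := fun p =>
        ((p.1.2 + p.2.1 + p.2.2, p.1.1 + p.1.2), (p.1.1 + p.1.2 + p.2.2, p.2.1 + p.2.2))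
      map_add' := ?_
      map_smul' := ?_
      left_inv := ?_
      right_inv := ?_
      map_app' := ?_ }⟩
  · intro p q
    ext <;> simp <;> ring
  · intro a p
    ext <;> simp <;> ring
  · unfold Function.LeftInverse; decide
  · unfold Function.RightInverse Function.LeftInverse; decide
  · simp only [QuadraticMap.prod_apply, plane_apply]; decide

/-- If `r` is orthogonal to a hyperbolic pair `x, y` and takes the value `1`, then `x + r, y + r`
span an anisotropic plane. -/
theorem plane_zero_prod_sq_equivalent :
    ((plane 0).prod (QuadraticMap.sq : QuadraticForm (ZMod 2) (ZMod 2))).Equivalent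
      ((plane 1).prod QuadraticMap.sq) := by
  refine ⟨{ toFun := fun p => (p.1, p.1.1 + p.1.2 + p.2)
            invFun := fun p => (p.1, p.1.1 + p.1.2 + p.2)
            map_add' := ?_
            map_smul' := ?_
            left_inv := ?_
            right_inv := ?_
            map_app' := ?_ }⟩
  · intro p q
    ext <;> simp; ring
  · intro a p
    ext <;> simp; ring
  · unfold Function.LeftInverse; decide
  · unfold Function.RightInverse Function.LeftInverse; decide
  · simp only [QuadraticMap.prod_apply, plane_apply, QuadraticMap.sq_apply]; decide

variable {V : Type*} [AddCommGroup V] [Module (ZMod 2) V]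

theorem zmod_two_eq_zero_or_one (a : ZMod 2) : a = 0 ∨ a = 1 := by
  revert a; decide

theorem map_add_eq (Q : QuadraticForm (ZMod 2) V) (u v : V) :
    Q (u + v) = Q u + Q v + polar Q u v := by
  rw [polar]; ring

theorem polar_self_eq_zero (Q : QuadraticForm (ZMod 2) V) (u : V) : polar Q u u = 0 := by
  rw [QuadraticMap.polar_self, CharTwo.two_nsmul]

/-- Two vectors `u, v` that are not orthogonal may be chosen with `Q u = Q v`: among `u`, `v` and
`u + v`, which are pairwise not orthogonal, two have the same value. -/
theorem exists_polar_eq_one_of_polar_ne_zero (Q : QuadraticForm (ZMod 2) V) {u v : V}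
    (h : polar Q u v ≠ 0) : ∃ u v, polar Q u v = 1 ∧ Q u = Q v := by
  have h1 : polar Q u v = 1 := (zmod_two_eq_zero_or_one _).resolve_left h
  by_cases huv : Q u = Q v
  · exact ⟨u, v, h1, huv⟩
  have h2 := map_add_eq Q u v
  rw [h1] at h2
  by_cases hu : Q (u + v) = Q u
  · exact ⟨u + v, u, by rw [polar_add_left, polar_self_eq_zero, polar_comm, h1, zero_add], hu⟩
  · refine ⟨u + v, v, by rw [polar_add_left, polar_self_eq_zero, h1, add_zero], ?_⟩
    revert h2 huv hu
    generalize Q (u + v) = a, Q u = b, Q v = c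
    revert a b c
    decide

/-- Splitting off a plane: if `B(u, v) = 1` and `Q u = Q v`, then `V` is the orthogonal sum of the
plane spanned by `u` and `v` and its orthogonal complement. -/
theorem exists_equivalent_plane_prod (Q : QuadraticForm (ZMod 2) V) [FiniteDimensional (ZMod 2) V]
    {u v : V} (h : polar Q u v = 1) (hQ : Q u = Q v) :
    ∃ W : Submodule (ZMod 2) V, Module.finrank (ZMod 2) W < Module.finrank (ZMod 2) V ∧
      Q.Equivalent ((plane (Q u)).prod (Q.restrict W)) := by
  let fu : V →ₗ[ZMod 2] ZMod 2 := Q.polarBilin u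
  let fv : V →ₗ[ZMod 2] ZMod 2 := Q.polarBilin v
  have fuu : fu u = 0 := polar_self_eq_zero Q u
  have fvv : fv v = 0 := polar_self_eq_zero Q v
  have fuv : fu v = 1 := h
  have fvu : fv u = 1 := by rw [← h, polar_comm]; rfl
  let W : Submodule (ZMod 2) V := LinearMap.ker fu ⊓ LinearMap.ker fv
  have hW (w : W) : fu w = 0 ∧ fv w = 0 := w.2
  refine ⟨W, Submodule.finrank_lt fun hW => ?_, QuadraticMap.Equivalent.symm ⟨?_⟩⟩
  · have hv : v ∈ W := hW ▸ Submodule.mem_top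
    have : fu v = 0 := hv.1
    rw [fuv] at this
    exact one_ne_zero this
  · let F : (ZMod 2 × ZMod 2) × W →ₗ[ZMod 2] V :=
      (((LinearMap.toSpanSingleton (ZMod 2) V u).coprod
        (LinearMap.toSpanSingleton (ZMod 2) V v)).coprod W.subtype)
    have hF (p : (ZMod 2 × ZMod 2) × W) : F p = p.1.1 • u + p.1.2 • v + p.2 := rfl
    have inj : Function.Injective F := by
      refine (injective_iff_map_eq_zero F).2 ?_
      rintro ⟨⟨a, b⟩, w⟩ h0
      rw [hF] at h0
      have hu := congrArg fu h0
      have hv := congrArg fv h0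
      simp [fuu, fuv, fvu, fvv, (hW w).1, (hW w).2] at hu hv
      subst hu hv
      simpa using h0
    have surj : Function.Surjective F := by
      intro x
      have hx : x - fv x • u - fu x • v ∈ W := by
        refine ⟨?_, ?_⟩ <;> simp [fuu, fuv, fvu, fvv]
      refine ⟨((fv x, fu x), ⟨_, hx⟩), ?_⟩
      rw [hF]
      simp only
      abel
    refine { LinearEquiv.ofBijective F ⟨inj, surj⟩ with map_app' := ?_ }
    rintro ⟨⟨a, b⟩, w⟩
    change Q (a • u + b • v + (w : V)) = _
    have hw : polar Q (a • u + b • v) w = 0 := by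
      rw [polar_add_left, polar_smul_left, polar_smul_left]
      have h1 : polar Q u w = 0 := (hW w).1
      have h2 : polar Q v w = 0 := (hW w).2
      simp [h1, h2]
    rw [map_add_eq, hw, map_add_eq, polar_smul_left, polar_smul_right, h, QuadraticMap.map_smul,
      QuadraticMap.map_smul, ← hQ]
    simp only [QuadraticMap.prod_apply, plane_apply, QuadraticMap.restrict_apply, smul_eq_mul]
    ring

/-- A form whose bilinear form vanishes is the square of a linear functional, as it is itself
additive and `x = x ^ 2` on `ℤ/2`. -/
theorem equivalent_zero_or_sq_prod_zero (Q : QuadraticForm (ZMod 2) V)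
    [FiniteDimensional (ZMod 2) V] (h : ∀ u v, polar Q u v = 0) :
    ∃ n : ℕ, Q.Equivalent (0 : QuadraticForm (ZMod 2) (Fin n → ZMod 2)) ∨
      Q.Equivalent ((QuadraticMap.sq : QuadraticForm (ZMod 2) (ZMod 2)).prod
        (0 : QuadraticForm (ZMod 2) (Fin n → ZMod 2))) := by
  let f : V →ₗ[ZMod 2] ZMod 2 :=
    { toFun := Q
      map_add' := fun u v => by rw [map_add_eq, h, add_zero]
      map_smul' := fun a v => by
        obtain rfl | rfl := zmod_two_eq_zero_or_one a <;> simp }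
  have hf (v : V) : Q v = f v := rfl
  by_cases hr : ∃ r, Q r ≠ 0
  · obtain ⟨r, hr⟩ := hr
    have hr : f r = 1 := (zmod_two_eq_zero_or_one _).resolve_left hr
    let e := (Module.finBasis (ZMod 2) (LinearMap.ker f)).equivFun
    refine ⟨Module.finrank (ZMod 2) (LinearMap.ker f),
      Or.inr (QuadraticMap.Equivalent.symm ⟨?_⟩)⟩
    let F : ZMod 2 × (Fin (Module.finrank (ZMod 2) (LinearMap.ker f)) → ZMod 2) →ₗ[ZMod 2] V :=
      (LinearMap.toSpanSingleton (ZMod 2) V r).coprod ((LinearMap.ker f).subtype ∘ₗ e.symm)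
    have hF (p) : F p = p.1 • r + (e.symm p.2 : V) := rfl
    have hfF (p) : f (F p) = p.1 := by simp [hF, hr]
    have inj : Function.Injective F := by
      refine (injective_iff_map_eq_zero F).2 fun p h0 => ?_
      have h1 : p.1 = 0 := by rw [← hfF, h0, map_zero]
      have h2 : e.symm p.2 = 0 := by
        rw [hF, h1, zero_smul, zero_add] at h0
        exact Subtype.ext h0
      exact Prod.ext h1 (by simpa using h2)
    have surj : Function.Surjective F := by
      intro x
      have hx : x - f x • r ∈ LinearMap.ker f := by simp [hr]
      exact ⟨(f x, e ⟨_, hx⟩), by simp [hF]⟩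
    refine { LinearEquiv.ofBijective F ⟨inj, surj⟩ with map_app' := fun p => ?_ }
    change f (F p) = _
    rw [hfF]
    obtain h | h := zmod_two_eq_zero_or_one p.1 <;> simp [h]
  · push Not at hr
    exact ⟨_, Or.inl ⟨{ (Module.finBasis (ZMod 2) V).equivFun with
      map_app' := fun v => by simp [hr] }⟩⟩

/-- Classification of the quadratic forms over `ℤ/2`: up to isometry, such a form is a sum of
anisotropic planes, at most one further summand, which is a hyperbolic plane or the line `x ^ 2`,
and a zero form. -/
theorem exists_equivalent_planePow_prod (Q : QuadraticForm (ZMod 2) V)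
    [FiniteDimensional (ZMod 2) V] :
    ∃ m n : ℕ,
      Q.Equivalent ((planePow m).prod (0 : QuadraticForm (ZMod 2) (Fin n → ZMod 2))) ∨
      Q.Equivalent ((planePow m).prod
        ((plane 0).prod (0 : QuadraticForm (ZMod 2) (Fin n → ZMod 2)))) ∨
      Q.Equivalent ((planePow m).prod
        ((QuadraticMap.sq : QuadraticForm (ZMod 2) (ZMod 2)).prod
          (0 : QuadraticForm (ZMod 2) (Fin n → ZMod 2)))) := by
  induction hd : Module.finrank (ZMod 2) V using Nat.strong_induction_on generalizing V with
  | _ d ih =>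
  by_cases hB : ∀ u v, polar Q u v = 0
  · -- The space `Fin 0 → _` is trivial, so that the empty sum `planePow 0` may be added.
    have zero_prod {T : Type} [AddCommGroup T] [Module (ZMod 2) T] (R : QuadraticForm (ZMod 2) T) :
        R.Equivalent ((planePow 0).prod R) :=
      QuadraticMap.Equivalent.symm
        ⟨{ LinearEquiv.uniqueProd (R := ZMod 2) (M := T) (M₂ := Fin 0 → ZMod 2 × ZMod 2) with
            map_app' := fun p => by simp [planePow_apply] }⟩
    obtain ⟨n, h | h⟩ := equivalent_zero_or_sq_prod_zero Q hB
    · exact ⟨0, n, Or.inl (h.trans (zero_prod _))⟩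
    · exact ⟨0, n, Or.inr (Or.inr (h.trans (zero_prod _)))⟩
  · push Not at hB
    obtain ⟨u, v, huv⟩ := hB
    obtain ⟨u, v, huv, hQ⟩ := exists_polar_eq_one_of_polar_ne_zero Q huv
    obtain ⟨W, hWd, hW⟩ := exists_equivalent_plane_prod Q huv hQ
    obtain ⟨m, n, h⟩ := ih _ (hd ▸ hWd) (Q.restrict W) rfl
    obtain hu | hu := zmod_two_eq_zero_or_one (Q u) <;> rw [hu] at hW
    · have step {T : Type} [AddCommGroup T] [Module (ZMod 2) T] {R : QuadraticForm (ZMod 2) T}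
          (h : (Q.restrict W).Equivalent ((planePow m).prod R)) :
          Q.Equivalent ((planePow m).prod ((plane 0).prod R)) :=
        hW.trans (((QuadraticMap.Equivalent.refl _).prod h).trans
          (equivalent_prod_left_comm _ _ _))
      obtain h | h | h := h
      · exact ⟨m, n, Or.inr (Or.inl (step h))⟩
      · refine ⟨m + 1 + 1, n, Or.inl ((step h).trans ?_)⟩
        refine QuadraticMap.Equivalent.trans ?_
          (planePow_prod_plane_one_prod_equivalent (m + 1) _)
        refine QuadraticMap.Equivalent.trans ?_ (planePow_prod_plane_one_prod_equivalent m _)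
        exact (QuadraticMap.Equivalent.refl _).prod ((equivalent_prod_assoc _ _ _).symm.trans
          ((plane_zero_prod_plane_zero_equivalent.prod (.refl _)).trans
            (equivalent_prod_assoc _ _ _)))
      · refine ⟨m + 1, n, Or.inr (Or.inr ((step h).trans ?_))⟩
        refine QuadraticMap.Equivalent.trans ?_ (planePow_prod_plane_one_prod_equivalent m _)
        exact (QuadraticMap.Equivalent.refl _).prod ((equivalent_prod_assoc _ _ _).symm.trans
          ((plane_zero_prod_sq_equivalent.prod (.refl _)).trans (equivalent_prod_assoc _ _ _)))
    · have step {T : Type} [AddCommGroup T] [Module (ZMod 2) T] {R : QuadraticForm (ZMod 2) T}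
          (h : (Q.restrict W).Equivalent ((planePow m).prod R)) :
          Q.Equivalent ((planePow (m + 1)).prod R) :=
        hW.trans (((QuadraticMap.Equivalent.refl _).prod h).trans
          ((equivalent_prod_assoc _ _ _).symm.trans
            ((plane_one_prod_planePow_equivalent m).prod (.refl _))))
      exact ⟨m + 1, n, h.imp step (Or.imp step step)⟩

/-- For an admissible form, the vectors of value `1` outside the radical span the space, so that a
linear functional vanishing on them is zero. -/
theorem IsAdmissible.eq_zero_of_forall {Q : QuadraticForm (ZMod 2) V} (hQ : Q.IsAdmissible)
    (f : V →ₗ[ZMod 2] ZMod 2) (hf : ∀ v w, Q v = 1 → polar Q v w = 1 → f v = 0) : f = 0 := by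
  obtain ⟨l, b, h1, h2⟩ := hQ
  refine b.ext fun i => ?_
  obtain ⟨j, hj⟩ := h2 i
  exact hf _ _ (h1 i) hj

theorem IsAdmissible.of_equivalent {V' : Type*} [AddCommGroup V'] [Module (ZMod 2) V']
    {Q : QuadraticForm (ZMod 2) V} {Q' : QuadraticForm (ZMod 2) V'} (hQ : Q.IsAdmissible)
    (h : Q.Equivalent Q') : Q'.IsAdmissible := by
  obtain ⟨e⟩ := h
  obtain ⟨l, b, h1, h2⟩ := hQ
  have he (v : V) : Q' (e.toLinearEquiv v) = Q v := e.map_app v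
  refine ⟨l, b.map e.toLinearEquiv, fun i => ?_, fun i => ?_⟩
  · rw [Module.Basis.map_apply, he, h1]
  · obtain ⟨j, hj⟩ := h2 i
    exact ⟨j, by simpa only [Module.Basis.map_apply, polar, ← map_add, he] using hj⟩

theorem not_isAdmissible_plane_zero {n : ℕ} :
    ¬ IsAdmissible ((planePow 0).prod
      ((plane 0).prod (0 : QuadraticForm (ZMod 2) (Fin n → ZMod 2)))) := by
  intro h
  -- The vectors of value `1` have both coordinates in the hyperbolic plane equal to `1`.
  let f : (Fin 0 → ZMod 2 × ZMod 2) × (ZMod 2 × ZMod 2) × (Fin n → ZMod 2) →ₗ[ZMod 2] ZMod 2 :=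
    ((LinearMap.fst _ _ _ + LinearMap.snd _ _ _) ∘ₗ LinearMap.fst _ _ _) ∘ₗ LinearMap.snd _ _ _
  have hf : f = 0 := by
    refine h.eq_zero_of_forall f ?_
    rintro ⟨x, ⟨a, b⟩, y⟩ - h1 -
    change a + b = 0
    simp [planePow_apply] at h1
    revert a b; decide
  exact one_ne_zero (α := ZMod 2) (by simpa [f] using LinearMap.congr_fun hf (0, (1, 0), 0))

/-- With at most one plane, a vector outside the radical has nonzero component in the plane, where
it takes the value `1`. A vector of value `1` then has no component along the line `x ^ 2`. -/
theorem not_isAdmissible_planePow_prod_sq {m n : ℕ} (hm : m ≤ 1) :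
    ¬ IsAdmissible ((planePow m).prod ((QuadraticMap.sq : QuadraticForm (ZMod 2) (ZMod 2)).prod
      (0 : QuadraticForm (ZMod 2) (Fin n → ZMod 2)))) := by
  intro h
  let f : (Fin m → ZMod 2 × ZMod 2) × ZMod 2 × (Fin n → ZMod 2) →ₗ[ZMod 2] ZMod 2 :=
    LinearMap.fst _ _ _ ∘ₗ LinearMap.snd _ _ _
  have hf : f = 0 := by
    refine h.eq_zero_of_forall f ?_
    rintro ⟨x, t, y⟩ ⟨x', t', y'⟩ h1 h2
    change t = 0
    rw [polar_prod, polar_prod] at h2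
    have ht : polar (QuadraticMap.sq : QuadraticForm (ZMod 2) (ZMod 2)) t t' = 0 := by
      have key : ∀ s s' : ZMod 2, (s + s') * (s + s') - s * s - s' * s' = 0 := by decide
      exact key t t'
    have hx : planePow m x = 1 := by
      have hx0 : polar (planePow m) x x' ≠ 0 := by
        intro h0
        simp only [h0, ht] at h2
        simp [polar] at h2
      have hx1 : x ≠ 0 := by
        rintro rfl
        exact hx0 (QuadraticMap.polar_zero_left _ _)
      interval_cases m
      · exact absurd (Subsingleton.elim _ _) hx1
      · rw [planePow_apply, Fin.sum_univ_one, plane_apply]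
        have : x 0 ≠ 0 := fun h0 => hx1 (funext fun i => by rw [Subsingleton.elim i 0, h0]; rfl)
        revert this
        generalize x 0 = p
        revert p; decide
    rw [QuadraticMap.prod_apply, hx] at h1
    simpa using h1
  exact one_ne_zero (α := ZMod 2) (by simpa [f] using LinearMap.congr_fun hf (0, 1, 0))

end QuadraticForm

/-! ### Extensions of a quadratic space by a central involution -/

/-- A group `G` with an involution `c` and a surjection `proj` onto the space `V` with kernel
`{1, c}`, such that `g ^ 2 = c ^ Q (proj g)`. -/
structure QuadraticExtension (G : Type*) [Group G] {V : Type*} [AddCommGroup V] [Module (ZMod 2) V]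
    (Q : QuadraticForm (ZMod 2) V) where
  /-- The generator of the kernel. -/
  c : G
  c_ne_one : c ≠ 1
  /-- The projection onto `V`, written multiplicatively. -/
  proj : G →* Multiplicative V
  proj_surjective : Function.Surjective proj
  proj_eq_one_iff (g : G) : proj g = 1 ↔ g = 1 ∨ g = c
  sq_eq (g : G) : g ^ 2 = c ^ (Q (proj g).toAdd).val

/-- In a group of exponent two, a nontrivial element is detected by a homomorphism to `ℤ/2`. -/
theorem exists_monoidHom_zmod_two_ne_one {A : Type*} [Group A] (hA : ∀ a : A, a ^ 2 = 1) {z : A}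
    (hz : z ≠ 1) : ∃ χ : A →* Multiplicative (ZMod 2), χ z ≠ 1 := by
  let _ : CommGroup A :=
    { (inferInstance : Group A) with
      mul_comm := fun a b =>
        Commute.of_orderOf_dvd_two (fun g => orderOf_dvd_of_pow_eq_one (hA g)) a b }
  let _ : Module (ZMod 2) (Additive A) :=
    AddCommGroup.zmodModule (n := 2) fun a => congrArg Additive.ofMul (hA a.toMul)
  obtain ⟨f, hf⟩ := Module.Projective.exists_dual_ne_zero (ZMod 2)
    (show Additive.ofMul z ≠ 0 from fun h => hz (congrArg Additive.toMul h))
  exact ⟨AddMonoidHom.toMultiplicativeRight f.toAddMonoidHom, hf⟩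

theorem Subgroup.mem_zpowers_iff_of_sq_eq_one {A : Type*} [Group A] {a x : A} (ha : a ^ 2 = 1) :
    x ∈ Subgroup.zpowers a ↔ x = 1 ∨ x = a := by
  constructor
  · intro h
    obtain ⟨k, rfl⟩ := Subgroup.mem_zpowers_iff.1 h
    have h2 (j : ℤ) : a ^ (2 * j) = 1 := by
      rw [zpow_mul, zpow_ofNat, ha, one_zpow]
    obtain ⟨j, rfl | rfl⟩ := Int.even_or_odd' k
    · exact Or.inl (h2 j)
    · exact Or.inr (by rw [zpow_add, h2, one_mul, zpow_one])
  · rintro (rfl | rfl)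
    · exact one_mem _
    · exact Subgroup.mem_zpowers _

theorem Multiplicative.zmod_two_eq_of_ne_one {s t : Multiplicative (ZMod 2)} (hs : s ≠ 1)
    (ht : t ≠ 1) : s = t := by
  revert s t; decide

namespace QuadraticExtension

variable {G H : Type*} [Group G] [Group H]
  {V W : Type*} [AddCommGroup V] [Module (ZMod 2) V] [AddCommGroup W] [Module (ZMod 2) W]
  {Q : QuadraticForm (ZMod 2) V} {R : QuadraticForm (ZMod 2) W}

theorem proj_c (E : QuadraticExtension G Q) : E.proj E.c = 1 :=
  (E.proj_eq_one_iff _).2 (Or.inr rfl)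

theorem c_sq (E : QuadraticExtension G Q) : E.c ^ 2 = 1 := by
  rw [E.sq_eq, E.proj_c]; simp

theorem c_comm (E : QuadraticExtension G Q) (g : G) : g * E.c = E.c * g := by
  have h : E.proj (g * E.c * g⁻¹) = 1 := by simp [E.proj_c]
  rcases (E.proj_eq_one_iff _).1 h with h | h
  · exact absurd (by simpa [mul_inv_eq_one] using h) E.c_ne_one
  · exact mul_inv_eq_iff_eq_mul.1 h

theorem mem_zpowers_c (E : QuadraticExtension G Q) {g : G} :
    g ∈ Subgroup.zpowers E.c ↔ g = 1 ∨ g = E.c :=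
  Subgroup.mem_zpowers_iff_of_sq_eq_one E.c_sq

/-- An isometry of quadratic spaces carries extensions of one to extensions of the other. -/
def congr (E : QuadraticExtension G Q) (e : Q.IsometryEquiv R) : QuadraticExtension G R where
  c := E.c
  c_ne_one := E.c_ne_one
  proj := (AddMonoidHom.toMultiplicative e.toLinearEquiv.toAddEquiv.toAddMonoidHom).comp E.proj
  proj_surjective :=
    (show Function.Surjective _ from e.toLinearEquiv.surjective).comp E.proj_surjective
  proj_eq_one_iff g := by
    rw [← E.proj_eq_one_iff]
    exact e.toLinearEquiv.map_eq_zero_iff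
  sq_eq g := by
    rw [E.sq_eq]
    exact congrArg (fun k : ZMod 2 => E.c ^ k.val) (e.map_app _).symm

/-- Two groups extending the same quadratic space are isomorphic. On the fibre product `P` of `G`
and `H` over `V`, squares lie in `D = {1, (c, c')}`, so that `P / D` has exponent two and `(c, 1)`
is detected by a homomorphism `χ : P → ℤ/2` that is trivial on `D`. The kernel of `χ` is the graph
of an isomorphism. -/
theorem nonempty_mulEquiv (E : QuadraticExtension G Q) (F : QuadraticExtension H Q) :
    Nonempty (G ≃* H) := by
  let P : Subgroup (G × H) :=
    (E.proj.comp (MonoidHom.fst G H)).eqLocus (F.proj.comp (MonoidHom.snd G H))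
  have mem_P (x : G × H) : x ∈ P ↔ E.proj x.1 = F.proj x.2 := Iff.rfl
  let d : P := ⟨(E.c, F.c), by rw [mem_P, E.proj_c, F.proj_c]⟩
  let z : P := ⟨(E.c, 1), by rw [mem_P, E.proj_c, map_one]⟩
  let z' : P := ⟨(1, F.c), by rw [mem_P, F.proj_c, map_one]⟩
  have hzz' : z * z' = d := Subtype.ext (Prod.ext (mul_one _) (one_mul _))
  have hd : d ^ 2 = 1 := Subtype.ext (Prod.ext E.c_sq F.c_sq)
  have d_comm (x : P) : x * d = d * x :=
    Subtype.ext (Prod.ext (E.c_comm _) (F.c_comm _))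
  let D : Subgroup P := Subgroup.zpowers d
  have mem_D {x : P} : x ∈ D ↔ x = 1 ∨ x = d := Subgroup.mem_zpowers_iff_of_sq_eq_one hd
  have : D.Normal := ⟨fun x hx y => by
    rcases mem_D.1 hx with rfl | rfl
    · simp
    · rwa [d_comm, mul_inv_cancel_right]⟩
  have sq_mem (x : P) : x ^ 2 ∈ D := by
    refine Subgroup.mem_zpowers_iff.2 ⟨(Q (E.proj x.1.1).toAdd).val, ?_⟩
    rw [zpow_natCast]
    refine Subtype.ext (Prod.ext (E.sq_eq _).symm ?_)
    change F.c ^ (Q (E.proj x.1.1).toAdd).val = x.1.2 ^ 2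
    rw [F.sq_eq, (mem_P _).1 x.2]
  have hz : (QuotientGroup.mk z : P ⧸ D) ≠ 1 := by
    rw [Ne, QuotientGroup.eq_one_iff, mem_D]
    rintro (h | h)
    · exact E.c_ne_one (congrArg (fun x : P => x.1.1) h)
    · exact F.c_ne_one (congrArg (fun x : P => x.1.2) h).symm
  obtain ⟨χ₀, hχ₀⟩ := exists_monoidHom_zmod_two_ne_one (A := P ⧸ D)
    (fun a => by
      obtain ⟨x, rfl⟩ := QuotientGroup.mk_surjective a
      exact (QuotientGroup.eq_one_iff _).2 (sq_mem x)) hz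
  let χ : P →* Multiplicative (ZMod 2) := χ₀.comp (QuotientGroup.mk' D)
  have χz : χ z ≠ 1 := hχ₀
  have χd : χ d = 1 := by
    have : (QuotientGroup.mk d : P ⧸ D) = 1 :=
      (QuotientGroup.eq_one_iff _).2 (Subgroup.mem_zpowers d)
    change χ₀ (QuotientGroup.mk d) = 1
    rw [this, map_one]
  have χz' : χ z' ≠ 1 := fun h => χz (by rw [← χd, ← hzz', map_mul, h, mul_one])
  have χ_mul {x y : P} (hx : χ x ≠ 1) (hy : χ y ≠ 1) : x * y ∈ χ.ker := by
    rw [MonoidHom.mem_ker, map_mul]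
    revert hx hy
    generalize χ x = s, χ y = t
    revert s t; decide
  let toG : χ.ker →* G := ((MonoidHom.fst G H).comp P.subtype).comp χ.ker.subtype
  let toH : χ.ker →* H := ((MonoidHom.snd G H).comp P.subtype).comp χ.ker.subtype
  have toG_bij : Function.Bijective toG := by
    refine ⟨(injective_iff_map_eq_one _).2 ?_, fun g => ?_⟩
    · rintro ⟨⟨⟨g, h⟩, hP⟩, hχ⟩ (rfl : g = 1)
      have h1 : F.proj h = 1 := by rw [← (mem_P _).1 hP, map_one]
      rcases (F.proj_eq_one_iff h).1 h1 with rfl | rfl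
      · rfl
      · exact absurd hχ χz'
    · obtain ⟨h, hh⟩ := F.proj_surjective (E.proj g)
      let x : P := ⟨(g, h), hh.symm⟩
      by_cases hx : χ x = 1
      · exact ⟨⟨x, hx⟩, rfl⟩
      · exact ⟨⟨x * z', χ_mul hx χz'⟩, mul_one g⟩
  have toH_bij : Function.Bijective toH := by
    refine ⟨(injective_iff_map_eq_one _).2 ?_, fun h => ?_⟩
    · rintro ⟨⟨⟨g, h⟩, hP⟩, hχ⟩ (rfl : h = 1)
      have h1 : E.proj g = 1 := by rw [(mem_P _).1 hP, map_one]
      rcases (E.proj_eq_one_iff g).1 h1 with rfl | rfl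
      · rfl
      · exact absurd hχ χz
    · obtain ⟨g, hg⟩ := E.proj_surjective (F.proj h)
      let x : P := ⟨(g, h), hg⟩
      by_cases hx : χ x = 1
      · exact ⟨⟨x, hx⟩, rfl⟩
      · exact ⟨⟨x * z, χ_mul hx χz⟩, mul_one h⟩
  exact ⟨(MulEquiv.ofBijective toG toG_bij).symm.trans (MulEquiv.ofBijective toH toH_bij)⟩

/-- If the form is not zero, `c` is a square, and it lies in every maximal subgroup `M`: otherwise
`M` and `c` generate the group, and every square is the square of an element of `M`. The reverse
inclusion holds as hyperplanes of `V` yield maximal subgroups. -/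
theorem zpowers_c_eq_frattini (E : QuadraticExtension G Q) (hQ : ∃ v, Q v = 1) :
    Subgroup.zpowers E.c = frattini G := by
  refine le_antisymm (Subgroup.zpowers_le.2 ?_) fun x hx => ?_
  · simp only [frattini, Order.radical, Subgroup.mem_iInf]
    intro M hM
    by_contra hc
    obtain ⟨v, hv⟩ := hQ
    obtain ⟨g, hg⟩ := E.proj_surjective (Multiplicative.ofAdd v)
    have hgc : g ^ 2 = E.c := by
      rw [E.sq_eq, hg, toAdd_ofAdd, hv, ZMod.val_one, pow_one]
    have : (Subgroup.zpowers E.c).Normal := ⟨fun y hy z => by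
      rcases E.mem_zpowers_c.1 hy with rfl | rfl
      · simp
      · rwa [E.c_comm, mul_inv_cancel_right]⟩
    have htop : Subgroup.zpowers E.c ⊔ M = ⊤ :=
      hM.2 _ (lt_of_le_of_ne le_sup_right fun h => hc (h ▸
        (le_sup_left : _ ≤ Subgroup.zpowers E.c ⊔ M) (Subgroup.mem_zpowers _)))
    obtain ⟨y, hy, m, hm, rfl⟩ :=
      Subgroup.mem_sup_of_normal_left.1 (htop ▸ Subgroup.mem_top g)
    refine hc ?_
    rw [← hgc]
    rcases E.mem_zpowers_c.1 hy with rfl | rfl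
    · rw [one_mul]
      exact M.pow_mem hm 2
    · rw [(show Commute E.c m from (E.c_comm m).symm).mul_pow, E.c_sq, one_mul]
      exact M.pow_mem hm 2
  · by_contra hxc
    have hV (a : Multiplicative V) : a ^ 2 = 1 := by
      change (2 : ℕ) • a.toAdd = 0
      rw [← Nat.cast_smul_eq_nsmul (ZMod 2)]
      exact zero_smul _ _
    obtain ⟨χ, hχ⟩ := exists_monoidHom_zmod_two_ne_one hV
      (fun h => hxc (E.mem_zpowers_c.2 ((E.proj_eq_one_iff x).1 h)))
    have hM : IsCoatom (χ.comp E.proj).ker := by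
      refine ⟨fun h => hχ ?_, fun K hK => ?_⟩
      · exact (h ▸ Subgroup.mem_top x : x ∈ (χ.comp E.proj).ker)
      · obtain ⟨y, hyK, hy⟩ := SetLike.exists_of_lt hK
        refine (Subgroup.eq_top_iff' K).2 fun g => ?_
        by_cases hg : g ∈ (χ.comp E.proj).ker
        · exact hK.le hg
        · have h1 : g * y⁻¹ ∈ (χ.comp E.proj).ker := by
            rw [MonoidHom.mem_ker, map_mul, map_inv, mul_inv_eq_one]
            exact Multiplicative.zmod_two_eq_of_ne_one hg hy
          simpa using K.mul_mem (hK.le h1) hyK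
    exact hχ (frattini_le_coatom hM hx)

/-- Dividing `G × H` by the diagonal involution gives an extension of the orthogonal sum. -/
def quotientProd (E : QuadraticExtension G Q) (F : QuadraticExtension H R)
    (N : Subgroup (G × H)) [N.Normal] (hN : N = Subgroup.zpowers (E.c, F.c)) :
    QuadraticExtension ((G × H) ⧸ N) (Q.prod R) :=
  have mem_N (x : G × H) : x ∈ N ↔ x = 1 ∨ x = (E.c, F.c) := by
    rw [hN]
    exact Subgroup.mem_zpowers_iff_of_sq_eq_one (Prod.ext E.c_sq F.c_sq)
  let ψ : G × H →* Multiplicative (V × W) :=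
    { toFun := fun x => Multiplicative.ofAdd ((E.proj x.1).toAdd, (F.proj x.2).toAdd)
      map_one' := by simp
      map_mul' := fun x y => by simp only [Prod.fst_mul, Prod.snd_mul, map_mul]; rfl }
  have ψ_eq_one (x : G × H) : ψ x = 1 ↔ E.proj x.1 = 1 ∧ F.proj x.2 = 1 := Prod.ext_iff
  have mk_c_c : (QuotientGroup.mk (E.c, F.c) : (G × H) ⧸ N) = 1 :=
    (QuotientGroup.eq_one_iff _).2 ((mem_N _).2 (Or.inr rfl))
  have mk_one_c : (QuotientGroup.mk (1, F.c) : (G × H) ⧸ N) = QuotientGroup.mk (E.c, 1) := by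
    rw [← mul_one (QuotientGroup.mk (1, F.c) : (G × H) ⧸ N), ← mk_c_c, ← QuotientGroup.mk_mul,
      Prod.mk_mul_mk, one_mul, ← pow_two, F.c_sq]
  have hψ : N ≤ ψ.ker := fun x hx => by
    rw [MonoidHom.mem_ker, ψ_eq_one]
    rcases (mem_N x).1 hx with rfl | rfl
    · simp
    · exact ⟨E.proj_c, F.proj_c⟩
  { c := QuotientGroup.mk (E.c, 1)
    c_ne_one := by
      rw [Ne, QuotientGroup.eq_one_iff, mem_N]
      rintro (h | h)
      · exact E.c_ne_one (congrArg Prod.fst h)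
      · exact F.c_ne_one (congrArg Prod.snd h).symm
    proj := QuotientGroup.lift N ψ hψ
    proj_surjective := fun v => by
      obtain ⟨g, hg⟩ := E.proj_surjective (Multiplicative.ofAdd v.toAdd.1)
      obtain ⟨h, hh⟩ := F.proj_surjective (Multiplicative.ofAdd v.toAdd.2)
      exact ⟨QuotientGroup.mk (g, h), Prod.ext hg hh⟩
    proj_eq_one_iff := fun x => by
      obtain ⟨⟨g, h⟩, rfl⟩ := QuotientGroup.mk_surjective x
      constructor
      · intro hx
        obtain ⟨hg, hh⟩ := (ψ_eq_one (g, h)).1 hx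
        rcases (E.proj_eq_one_iff g).1 hg with rfl | rfl <;>
          rcases (F.proj_eq_one_iff h).1 hh with rfl | rfl
        · exact Or.inl rfl
        · exact Or.inr mk_one_c
        · exact Or.inr rfl
        · exact Or.inl mk_c_c
      · rintro (hx | hx) <;> rw [hx]
        · exact map_one _
        · exact (ψ_eq_one _).2 ⟨E.proj_c, map_one _⟩
    sq_eq := fun x => by
      obtain ⟨⟨g, h⟩, rfl⟩ := QuotientGroup.mk_surjective x
      rw [← QuotientGroup.mk_pow, Prod.pow_mk, E.sq_eq, F.sq_eq]
      change _ = QuotientGroup.mk (E.c, 1) ^ (Q (E.proj g).toAdd + R (F.proj h).toAdd).val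
      generalize Q (E.proj g).toAdd = a, R (F.proj h).toAdd = b
      obtain rfl | rfl := QuadraticForm.zmod_two_eq_zero_or_one a <;>
        obtain rfl | rfl := QuadraticForm.zmod_two_eq_zero_or_one b <;>
        simp only [add_zero, zero_add, CharTwo.add_self_eq_zero, ZMod.val_zero, ZMod.val_one,
          pow_zero, pow_one]
      · rfl
      · exact mk_one_c
      · exact mk_c_c }

/-- The central product of extensions of nonzero forms extends the orthogonal sum. -/
def centralProduct (E : QuadraticExtension G Q) (F : QuadraticExtension H R) (hQ : ∃ v, Q v = 1)
    (hR : ∃ v, R v = 1) : QuadraticExtension (CentralProduct G H) (Q.prod R) :=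
  quotientProd E F _ <| by
    have c_comm (x : G × H) : x * (E.c, F.c) = (E.c, F.c) * x :=
      Prod.ext (E.c_comm _) (F.c_comm _)
    have hc : (E.c, F.c) ^ 2 = 1 := Prod.ext E.c_sq F.c_sq
    have : (Subgroup.zpowers (E.c, F.c)).Normal := ⟨fun y hy z => by
      rcases (Subgroup.mem_zpowers_iff_of_sq_eq_one hc).1 hy with rfl | rfl
      · simp
      · rwa [c_comm, mul_inv_cancel_right]⟩
    rw [← E.zpowers_c_eq_frattini hQ, ← F.zpowers_c_eq_frattini hR]
    refine le_antisymm (Subgroup.normalClosure_le_normal ?_)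
      (Subgroup.zpowers_le.2 (Subgroup.subset_normalClosure ⟨rfl, rfl⟩))
    rintro ⟨x, y⟩ ⟨hx, hy⟩
    have h1 : x = E.c := by
      rcases E.mem_zpowers_c.1 (hx ▸ Subgroup.mem_zpowers x) with rfl | h
      · exact absurd (by simpa using hx.symm) E.c_ne_one
      · exact h
    have h2 : y = F.c := by
      rcases F.mem_zpowers_c.1 (hy ▸ Subgroup.mem_zpowers y) with rfl | h
      · exact absurd (by simpa using hy.symm) F.c_ne_one
      · exact h
    rw [h1, h2]
    exact Subgroup.mem_zpowers _

/-- A direct elementary abelian factor adds a zero form. -/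
def prodElementary (E : QuadraticExtension G Q) (n : ℕ) :
    QuadraticExtension (G × (Fin n → Multiplicative (ZMod 2)))
      (Q.prod (0 : QuadraticForm (ZMod 2) (Fin n → ZMod 2))) where
  c := (E.c, 1)
  c_ne_one h := E.c_ne_one (congrArg Prod.fst h)
  proj :=
    { toFun := fun x => Multiplicative.ofAdd ((E.proj x.1).toAdd, fun i => (x.2 i).toAdd)
      map_one' := by simp only [Prod.fst_one, map_one]; rfl
      map_mul' := fun x y => by simp only [Prod.fst_mul, Prod.snd_mul, map_mul]; rfl }
  proj_surjective v := by
    obtain ⟨g, hg⟩ := E.proj_surjective (Multiplicative.ofAdd v.toAdd.1)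
    exact ⟨(g, fun i => Multiplicative.ofAdd (v.toAdd.2 i)), Prod.ext hg rfl⟩
  proj_eq_one_iff x := by
    have h : ∀ v : Multiplicative (V × (Fin n → ZMod 2)), v = 1 ↔ v.toAdd.1 = 0 ∧ v.toAdd.2 = 0 :=
      fun v => Prod.ext_iff
    rw [h, Prod.ext_iff, Prod.ext_iff]
    exact (and_congr (E.proj_eq_one_iff x.1) Iff.rfl).trans or_and_right
  sq_eq x := by
    refine Prod.ext ?_ (funext fun i => ?_)
    · refine (E.sq_eq x.1).trans ?_
      rw [Prod.pow_fst]
      exact congrArg (fun k : ZMod 2 => E.c ^ k.val) (add_zero _).symm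
    · have h (a : Multiplicative (ZMod 2)) : a ^ 2 = 1 := by revert a; decide
      rw [Prod.pow_snd, Prod.pow_snd, one_pow]
      exact h _

/-! ### The groups `Q₈`, `D₈`, `ℤ/4` and the central powers of `Q₈` -/

/-- The quaternion group `⟨a, x⟩`, with `a` and `x` mapping to the standard basis. -/
def quaternionGroup : QuadraticExtension (QuaternionGroup 2) (QuadraticForm.plane 1) where
  c := .a 2
  c_ne_one := by decide
  proj :=
    { toFun := fun
        | .a i => Multiplicative.ofAdd ((i.val : ZMod 2), 0)
        | .xa i => Multiplicative.ofAdd ((i.val : ZMod 2), 1)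
      map_one' := by decide
      map_mul' := by decide }
  proj_surjective := by unfold Function.Surjective; decide
  proj_eq_one_iff := by decide
  sq_eq := by simp only [QuadraticForm.plane_apply]; decide

/-- The dihedral group `⟨r, s⟩`, with the reflections `s` and `s r` mapping to the standard
basis. -/
def dihedralGroup : QuadraticExtension (DihedralGroup 4) (QuadraticForm.plane 0) where
  c := .r 2
  c_ne_one := by decide
  proj :=
    { toFun := fun
        | .r i => Multiplicative.ofAdd ((i.val : ZMod 2), (i.val : ZMod 2))
        | .sr i => Multiplicative.ofAdd ((i.val : ZMod 2) + 1, (i.val : ZMod 2))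
      map_one' := by decide
      map_mul' := by decide }
  proj_surjective := by unfold Function.Surjective; decide
  proj_eq_one_iff := by decide
  sq_eq := by simp only [QuadraticForm.plane_apply]; decide

/-- The cyclic group of order four. -/
def zmodFour : QuadraticExtension (Multiplicative (ZMod 4))
    (QuadraticMap.sq : QuadraticForm (ZMod 2) (ZMod 2)) where
  c := Multiplicative.ofAdd 2
  c_ne_one := by decide
  proj := AddMonoidHom.toMultiplicative (ZMod.castHom (by decide : 2 ∣ 4) (ZMod 2)).toAddMonoidHom
  proj_surjective := by unfold Function.Surjective; decide
  proj_eq_one_iff := by decide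
  sq_eq := by simp only [QuadraticMap.sq_apply]; decide

theorem exists_planePow_eq_one (m : ℕ) : ∃ v, QuadraticForm.planePow (m + 1) v = 1 :=
  ⟨Pi.single 0 (1, 0), by rw [QuadraticForm.planePow, QuadraticMap.pi_apply_single]; decide⟩

theorem nonempty_centralPower_quaternionGroup (m : ℕ) :
    Nonempty (QuadraticExtension (CentralPower (QuaternionGroup 2) (m + 1))
      (QuadraticForm.planePow (m + 1))) := by
  induction m with
  | zero => exact QuadraticForm.planePow_one_equivalent.symm.map quaternionGroup.congr
  | succ m ih =>
    obtain ⟨E⟩ := ih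
    exact ((QuadraticForm.equivalent_prod_comm _ _).trans
      (QuadraticForm.plane_one_prod_planePow_equivalent (m + 1))).map
        (E.centralProduct quaternionGroup (exists_planePow_eq_one m) ⟨(1, 0), by simp⟩).congr

/-! ### Generalized extraspecial groups -/

open IsGeneralizedExtraspecial in
/-- A generalized extraspecial group extends its own quadratic form. -/
theorem nonempty_quadraticForm (G : Type*) [Group G] [IsGeneralizedExtraspecial G] :
    Nonempty (QuadraticExtension G (quadraticForm G)) := by
  obtain ⟨⟨c, hc⟩, hc1⟩ : ∃ c : frattini G, c ≠ 1 := by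
    obtain ⟨a, b, hab, -⟩ := Nat.card_eq_two_iff.1 (card_frattini (G := G))
    have : Nontrivial (frattini G) := ⟨a, b, hab⟩
    exact exists_ne 1
  have hc1 : c ≠ 1 := fun h => hc1 (Subtype.ext h)
  have mem (g : G) : g ∈ frattini G ↔ g = 1 ∨ g = c := by
    refine ⟨fun hg => or_iff_not_imp_left.2 fun h => eq_of_mem hg hc h hc1, ?_⟩
    rintro (rfl | rfl)
    · exact one_mem _
    · exact hc
  exact ⟨{
    c := c
    c_ne_one := hc1
    proj :=
      { toFun := fun g => Multiplicative.ofAdd (FrattiniQuotient.mk g)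
        map_one' := rfl
        map_mul' := fun _ _ => rfl }
    proj_surjective := fun v => FrattiniQuotient.ind
      (p := fun v => ∃ g, Multiplicative.ofAdd (FrattiniQuotient.mk g) = Multiplicative.ofAdd v)
      (fun g => ⟨g, rfl⟩) v.toAdd
    proj_eq_one_iff := fun g =>
      (show _ ↔ (QuotientGroup.mk g : G ⧸ frattini G) = 1 from Iff.rfl).trans
        ((QuotientGroup.eq_one_iff g).trans (mem g))
    sq_eq := sq_eq_pow_quadraticForm (by
      ext g
      rw [Subgroup.mem_zpowers_iff_of_sq_eq_one (sq_eq_one_of_mem hc), mem]) }⟩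

end QuadraticExtension

/-- As `[G, G]` is not trivial, there are elements that do not commute. -/
theorem IsGeneralizedExtraspecial.exists_polar_ne_zero (G : Type*) [Group G]
    [IsGeneralizedExtraspecial G] :
    ∃ u v, QuadraticMap.polar (quadraticForm G) u v ≠ 0 := by
  by_contra! h
  have hcomm (g h' : G) : g * h' = h' * g := by
    have h1 := h (FrattiniQuotient.mk h') (FrattiniQuotient.mk g)
    rw [show ⇑(quadraticForm G) = squareMap from rfl, polar_squareMap, exponent] at h1
    by_contra hne
    rw [if_neg (fun hc => hne (commutatorElement_eq_one_iff_mul_comm.1 hc))] at h1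
    exact one_ne_zero h1
  have : commutator G = ⊥ := by
    rw [commutator_def, Subgroup.commutator_eq_bot_iff_le_centralizer]
    exact fun g _ => Subgroup.mem_centralizer_iff.2 fun h' _ => hcomm h' g
  have h2 := card_frattini (G := G)
  rw [frattini_eq_commutator, this] at h2
  simp at h2

theorem corollaryC (G : Type*) [Group G] [IsGeneralizedExtraspecial G]
    (hQ : (IsGeneralizedExtraspecial.quadraticForm G).IsAdmissible) :
    ∃ n m : ℕ,
      (1 ≤ m ∧ Nonempty (G ≃*
        CentralPower (QuaternionGroup 2) m × (Fin n → Multiplicative (ZMod 2)))) ∨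
      (2 ≤ m ∧ Nonempty (G ≃*
        CentralProduct (CentralPower (QuaternionGroup 2) (m - 1)) (DihedralGroup 4) ×
          (Fin n → Multiplicative (ZMod 2)))) ∨
      (2 ≤ m ∧ Nonempty (G ≃*
        CentralProduct (CentralPower (QuaternionGroup 2) m) (Multiplicative (ZMod 4)) ×
          (Fin n → Multiplicative (ZMod 2)))) := by
  obtain ⟨E⟩ := QuadraticExtension.nonempty_quadraticForm G
  have : FiniteDimensional (ZMod 2) (FrattiniQuotient G) := by
    obtain ⟨l, b, -⟩ := hQ
    exact b.finiteDimensional_of_finite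
  obtain ⟨m, n, h | h | h⟩ := QuadraticForm.exists_equivalent_planePow_prod
    (IsGeneralizedExtraspecial.quadraticForm G)
  · obtain ⟨e⟩ := h
    cases m with
    | zero =>
      -- The zero form is excluded, as `G` is not abelian.
      obtain ⟨u, v, huv⟩ := IsGeneralizedExtraspecial.exists_polar_ne_zero G
      refine absurd ?_ huv
      have h0 (w) : IsGeneralizedExtraspecial.quadraticForm G w = 0 := by
        rw [← e.map_app, QuadraticMap.prod_apply, QuadraticForm.planePow_apply]; rfl
      simp [QuadraticMap.polar, h0]
    | succ m =>
      obtain ⟨F⟩ := QuadraticExtension.nonempty_centralPower_quaternionGroup m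
      exact ⟨n, m + 1, Or.inl ⟨by lia, (E.congr e).nonempty_mulEquiv (F.prodElementary n)⟩⟩
  · have hQ' := hQ.of_equivalent h
    obtain ⟨e⟩ := h.trans (QuadraticForm.equivalent_prod_assoc _ _ _).symm
    cases m with
    | zero => exact absurd hQ' QuadraticForm.not_isAdmissible_plane_zero
    | succ m =>
      obtain ⟨F⟩ := QuadraticExtension.nonempty_centralPower_quaternionGroup m
      exact ⟨n, m + 1 + 1, Or.inr (Or.inl ⟨by lia, (E.congr e).nonempty_mulEquiv
        ((F.centralProduct .dihedralGroup (QuadraticExtension.exists_planePow_eq_one m)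
          ⟨(1, 1), by simp⟩).prodElementary n)⟩)⟩
  · have hm : 1 < m := by
      by_contra hm
      exact QuadraticForm.not_isAdmissible_planePow_prod_sq (by lia) (hQ.of_equivalent h)
    obtain ⟨e⟩ := h.trans (QuadraticForm.equivalent_prod_assoc _ _ _).symm
    obtain ⟨m, rfl⟩ : ∃ k, m = k + 1 := ⟨m - 1, by lia⟩
    obtain ⟨F⟩ := QuadraticExtension.nonempty_centralPower_quaternionGroup m
    exact ⟨n, m + 1, Or.inr (Or.inr ⟨by lia, (E.congr e).nonempty_mulEquiv
      ((F.centralProduct .zmodFour (QuadraticExtension.exists_planePow_eq_one m)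
        ⟨1, by simp⟩).prodElementary n)⟩)⟩
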